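/- Let $L/K$ be a finite Galois extension of fields and let $\mathcal{C}$ be a $K$-linear abelian category with enough injectives and with a set of generators (a family $(G_i)_{i\in I}$ of objects such that two morphisms $f,g\colon X\to Y$ are equal as soon as $f\circ h=g\circ h$ for all $i\in I$ and all $h\colon G_i\to X$). For a $K$-linear additive category $\mathcal{D}$ let $\mathcal{D}_L$ be the category of pairs $(X,f)$ with $X\in\mathcal{D}$ and $f\colon L\to\operatorname{End}_{\mathcal D}(X)$ a homomorphism of $K$-algebras; its morphisms are the morphisms of $\mathcal{D}$ that commute with the actions of $L$. Let $p^*\colon\mathcal{D}\to\mathcal{D}_L$, $X\mapsto L\otimes_K X$, be the left adjoint of the forgetful functor. Let $I(\mathcal{C})$ be the category of injective objects of $\mathcal{C}$, and let $\mathcal{A}$ be the DG-category of bounded below complexes in $I(\mathcal{C})$ with bounded cohomology, so that $H^0(\mathcal{A})\simeq \mathrm{D}^b(\mathcal{C})$. Let $\mathcal{A}_L$ be the DG-category of objects of $\mathcal{A}$ with an action of $L$; this is the DG-category of bounded below complexes in $I(\mathcal{C})_L$ whose underlying complex in $\mathcal{C}$ has bounded cohomology. It is pretriangulated, and $H^0(\mathcal{A}_L)=H^0((\mathcal{A}_L)^{pretr})$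 is the corresponding homotopy category of complexes in $I(\mathcal{C})_L$. Let $\mathrm{D}^b(\mathcal{C})_L$ be the smallest thick (closed under direct summands) full triangulated subcategory of $H^0(\mathcal{A}_L)$ that contains the image of $H^0(\mathcal{A})$ under $p^*$. For an object $E$ of a triangulated category $\mathcal{T}$ let $\langle E\rangle_1$ be the smallest full subcategory that contains $E$ and is closed under isomorphisms, finite direct sums, direct summands and shifts, and let $\langle E\rangle_{k+1}$ be the smallest full subcategory closed under the same operations that contains all $M$ for which there is a distinguished triangle $X\to M\to Y\to X[1]$ with $X\in\langle E\rangle_{k}$ and $Y\in\langle E\rangle_1$. The dimension $\dim(\mathcal{T})\in\mathbb{N}\cup\{\infty\}$ is the smallest $d\ge 0$ such that $\langle E\rangle_{d+1}=\mathcal{T}$ for some object $E$, and $\infty$ if there is no such $d$. If $\dim(\mathrm{D}^b(\mathcal{C}))$ is finite, then $$\dim(\mathrm{D}^b(\mathcal{C})_L)=\dim(\mathrm{D}^b(\mathcal{C})).$$ -/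

import Mathlib

open CategoryTheory CategoryTheory.Limits

universe w v u

noncomputable section

/-! ### Scalar extension of additive categories -/

/-- For a `K`-linear category `D`, the objects of the base change category `D_L`: pairs `(X, f)`
of an object `X` of `D` and a homomorphism of `K`-algebras `f : L → End X`. -/
structure ScalarExt (K L : Type*) [Field K] [Field L] [Algebra K L]
    (D : Type u) [Category.{v} D] [Preadditive D] [Linear K D] where
  /-- the underlying object -/
  obj : D
  /-- the action of `L` -/
  act : L →ₐ[K] End obj

namespace ScalarExt

variable {K L : Type*} [Field K] [Field L] [Algebra K L]
  {D : Type u} [Category.{v} D] [Preadditive D] [Linear K D]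

/-- The action of `l : L`, as a morphism. -/
def ρ (X : ScalarExt K L D) (l : L) : X.obj ⟶ X.obj := X.act l

lemma ρ_one (X : ScalarExt K L D) : X.ρ 1 = 𝟙 X.obj := map_one X.act

lemma ρ_mul (X : ScalarExt K L D) (l m : L) : X.ρ (l * m) = X.ρ l ≫ X.ρ m := by
  rw [mul_comm]; exact map_mul X.act m l

lemma ρ_zero (X : ScalarExt K L D) : X.ρ 0 = 0 := map_zero X.act

lemma ρ_add (X : ScalarExt K L D) (l m : L) : X.ρ (l + m) = X.ρ l + X.ρ m := map_add X.act l m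

lemma ρ_algebraMap (X : ScalarExt K L D) (r : K) : X.ρ (algebraMap K L r) = r • 𝟙 X.obj := by
  refine (AlgHom.commutes X.act r).trans ?_
  rw [Algebra.algebraMap_eq_smul_one]; rfl

/-- Constructor for objects of `D_L`. -/
def ofAction (X : D) (a : L → (X ⟶ X)) (one : a 1 = 𝟙 X)
    (mul : ∀ l m, a (l * m) = a l ≫ a m) (add : ∀ l m, a (l + m) = a l + a m)
    (scalar : ∀ r : K, a (algebraMap K L r) = r • 𝟙 X) : ScalarExt K L D where
  obj := X
  act :=
    { toFun := a
      map_one' := one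
      map_mul' l m := by rw [mul_comm]; exact mul m l
      map_zero' := by
        have h := add 0 0
        rw [add_zero] at h
        exact left_eq_add.1 h
      map_add' := add
      commutes' r := (scalar r).trans (Algebra.algebraMap_eq_smul_one (A := End X) r).symm }

/-- Morphisms of `D_L`: the morphisms of `D` that commute with the action of every `l : L`. -/
@[ext]
structure Hom (X Y : ScalarExt K L D) where
  /-- the underlying morphism -/
  hom : X.obj ⟶ Y.obj
  comm (l : L) : X.ρ l ≫ hom = hom ≫ Y.ρ l

lemma Hom.comm_assoc {X Y : ScalarExt K L D} (f : Hom X Y) (l : L) {Z : D} (g : Y.obj ⟶ Z) :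
    X.ρ l ≫ f.hom ≫ g = f.hom ≫ Y.ρ l ≫ g := by
  rw [← Category.assoc, f.comm, Category.assoc]

instance : Category (ScalarExt K L D) where
  Hom X Y := Hom X Y
  id X := { hom := 𝟙 X.obj, comm l := by simp }
  comp f g := { hom := f.hom ≫ g.hom, comm l := by rw [f.comm_assoc, g.comm, Category.assoc] }
  id_comp f := Hom.ext (Category.id_comp _)
  comp_id f := Hom.ext (Category.comp_id _)
  assoc f g h := Hom.ext (Category.assoc _ _ _)

@[ext]
lemma hom_ext {X Y : ScalarExt K L D} {f g : X ⟶ Y} (h : f.hom = g.hom) : f = g := Hom.ext h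

@[simp] lemma id_hom (X : ScalarExt K L D) : Hom.hom (𝟙 X) = 𝟙 X.obj := rfl

@[simp] lemma comp_hom {X Y Z : ScalarExt K L D} (f : X ⟶ Y) (g : Y ⟶ Z) :
    (f ≫ g).hom = f.hom ≫ g.hom := rfl

instance (X Y : ScalarExt K L D) : Zero (X ⟶ Y) := ⟨{ hom := 0, comm l := by simp }⟩

instance (X Y : ScalarExt K L D) : Add (X ⟶ Y) :=
  ⟨fun f g => { hom := f.hom + g.hom
                comm l := by rw [Preadditive.comp_add, Preadditive.add_comp, f.comm, g.comm] }⟩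

instance (X Y : ScalarExt K L D) : Neg (X ⟶ Y) :=
  ⟨fun f => { hom := -f.hom
              comm l := by rw [Preadditive.comp_neg, Preadditive.neg_comp, f.comm] }⟩

instance (X Y : ScalarExt K L D) : Sub (X ⟶ Y) :=
  ⟨fun f g => { hom := f.hom - g.hom
                comm l := by rw [Preadditive.comp_sub, Preadditive.sub_comp, f.comm, g.comm] }⟩

instance (X Y : ScalarExt K L D) : SMul ℕ (X ⟶ Y) :=
  ⟨fun n f => { hom := n • f.hom
                comm l := by rw [Preadditive.comp_nsmul, Preadditive.nsmul_comp, f.comm] }⟩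

instance (X Y : ScalarExt K L D) : SMul ℤ (X ⟶ Y) :=
  ⟨fun n f => { hom := n • f.hom
                comm l := by rw [Preadditive.comp_zsmul, Preadditive.zsmul_comp, f.comm] }⟩

lemma hom_injective (X Y : ScalarExt K L D) :
    Function.Injective (fun f : X ⟶ Y => f.hom) := fun _ _ h => Hom.ext h

instance (X Y : ScalarExt K L D) : AddCommGroup (X ⟶ Y) :=
  (hom_injective X Y).addCommGroup _ rfl (fun _ _ => rfl) (fun _ => rfl) (fun _ _ => rfl)
    (fun _ _ => rfl) (fun _ _ => rfl)

@[simp] lemma add_hom {X Y : ScalarExt K L D} (f g : X ⟶ Y) : (f + g).hom = f.hom + g.hom := rfl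

@[simp] lemma zero_hom (X Y : ScalarExt K L D) : (0 : X ⟶ Y).hom = 0 := rfl

instance : Preadditive (ScalarExt K L D) where
  add_comp _ _ _ _ _ _ := by ext; simp
  comp_add _ _ _ _ _ _ := by ext; simp

/-- The `L`-linear structure of `D_L`: the scalar `l` acts through the action on the source
(equivalently, on the target). -/
instance : Linear L (ScalarExt K L D) where
  homModule X Y :=
    { smul l f :=
        { hom := X.ρ l ≫ f.hom
          comm m := by
            rw [Category.assoc, ← f.comm, ← Category.assoc, ← Category.assoc, ← ρ_mul, ← ρ_mul,
              mul_comm] }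
      one_smul f := Hom.ext (show X.ρ 1 ≫ f.hom = f.hom by rw [ρ_one, Category.id_comp])
      mul_smul l m f := Hom.ext (show X.ρ (l * m) ≫ f.hom = X.ρ l ≫ X.ρ m ≫ f.hom by
        rw [ρ_mul, Category.assoc])
      smul_zero l := Hom.ext comp_zero
      smul_add l f g := Hom.ext (Preadditive.comp_add _ _ _ _ _ _)
      add_smul l m f := Hom.ext (show X.ρ (l + m) ≫ f.hom = X.ρ l ≫ f.hom + X.ρ m ≫ f.hom by
        rw [ρ_add, Preadditive.add_comp])
      zero_smul f := Hom.ext (show X.ρ 0 ≫ f.hom = 0 by rw [ρ_zero, zero_comp]) }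
  smul_comp _ _ _ _ _ _ := Hom.ext (Category.assoc _ _ _)
  comp_smul X Y Z f l g :=
    Hom.ext (show f.hom ≫ Y.ρ l ≫ g.hom = X.ρ l ≫ f.hom ≫ g.hom by rw [f.comm_assoc])

instance [HasZeroObject D] : HasZeroObject (ScalarExt K L D) := by
  obtain ⟨Z, hZ⟩ := HasZeroObject.zero (C := D)
  let Z' : ScalarExt K L D := ofAction Z (fun _ => 𝟙 Z) (hZ.eq_of_src _ _)
    (fun _ _ => hZ.eq_of_src _ _) (fun _ _ => hZ.eq_of_src _ _) (fun _ => hZ.eq_of_src _ _)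
  exact ⟨Z', (IsZero.iff_id_eq_zero Z').2 (hom_ext (hZ.eq_of_src _ _))⟩

/-- The direct sum of two objects of `D_L`, with the diagonal action. -/
def directSum [HasBinaryBiproducts D] (X Y : ScalarExt K L D) : ScalarExt K L D :=
  ofAction (X.obj ⊞ Y.obj) (fun l => biprod.map (X.ρ l) (Y.ρ l))
    (by apply biprod.hom_ext <;> simp [ρ_one])
    (fun l m => by apply biprod.hom_ext <;> simp [ρ_mul])
    (fun l m => by apply biprod.hom_ext <;> simp [ρ_add])
    (fun r => by apply biprod.hom_ext <;> simp [ρ_algebraMap])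

/-- `directSum X Y` is a biproduct of `X` and `Y` in `D_L`. -/
def directSumBicone [HasBinaryBiproducts D] (X Y : ScalarExt K L D) : BinaryBicone X Y where
  pt := directSum X Y
  fst := { hom := biprod.fst, comm _ := biprod.map_fst _ _ }
  snd := { hom := biprod.snd, comm _ := biprod.map_snd _ _ }
  inl := { hom := biprod.inl, comm _ := (biprod.inl_map _ _).symm }
  inr := { hom := biprod.inr, comm _ := (biprod.inr_map _ _).symm }
  inl_fst := hom_ext biprod.inl_fst
  inl_snd := hom_ext biprod.inl_snd
  inr_fst := hom_ext biprod.inr_fst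
  inr_snd := hom_ext biprod.inr_snd

instance [HasBinaryBiproducts D] : HasBinaryBiproducts (ScalarExt K L D) where
  has_binary_biproduct X Y :=
    HasBinaryBiproduct.mk
      { bicone := directSumBicone X Y
        isBilimit := isBinaryBilimitOfTotal _ (hom_ext biprod.total) }

variable (K L D)

/-- The forgetful functor `p_* : D_L ⥤ D`. -/
@[simps]
def forget : ScalarExt K L D ⥤ D where
  obj X := X.obj
  map f := f.hom

instance : (forget K L D).Additive where

variable {D} [HasFiniteBiproducts D] [FiniteDimensional K L]

/-- The object `L ⊗_K X` of `D_L`: the direct sum of copies of `X` indexed by a `K`-basis of `L`,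
on which `l : L` acts by the matrix of the multiplication by `l`. -/
def tensorObj (X : D) : ScalarExt K L D :=
  ofAction (⨁ fun _ : Fin (Module.finrank K L) => X)
    (fun l => biproduct.matrix fun i j =>
      Algebra.leftMulMatrix (Module.finBasis K L) l j i • 𝟙 X)
    (by
      refine biproduct.hom_ext' _ _ fun i => biproduct.hom_ext _ _ fun j => ?_
      simp [Matrix.one_apply, biproduct.ι_π, eq_comm])
    (fun l m => by
      refine biproduct.hom_ext' _ _ fun i => biproduct.hom_ext _ _ fun j => ?_
      rw [mul_comm]
      simp [Matrix.mul_apply, biproduct.lift_desc, Finset.sum_smul, smul_smul])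
    (fun l m => by
      refine biproduct.hom_ext' _ _ fun i => biproduct.hom_ext _ _ fun j => ?_
      simp [add_smul])
    (fun r => by
      refine biproduct.hom_ext' _ _ fun i => biproduct.hom_ext _ _ fun j => ?_
      simp [biproduct.ι_π, Matrix.algebraMap_matrix_apply, eq_comm, ite_smul])

/-- The functor `p^* : D ⥤ D_L`, `X ↦ L ⊗_K X`. -/
def tensor : D ⥤ ScalarExt K L D where
  obj X := tensorObj K L X
  map f :=
    { hom := biproduct.map fun _ => f
      comm l := by
        change biproduct.matrix _ ≫ biproduct.map _ = biproduct.map _ ≫ biproduct.matrix _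
        refine biproduct.hom_ext' _ _ fun i => biproduct.hom_ext _ _ fun j => ?_
        simp }
  map_id X := hom_ext (show biproduct.map (fun _ => 𝟙 X) = 𝟙 _ by
    refine biproduct.hom_ext _ _ fun j => ?_
    simp)
  map_comp f g := hom_ext
    (show biproduct.map (fun _ => f ≫ g) = biproduct.map (fun _ => f) ≫ biproduct.map (fun _ => g) by
      refine biproduct.hom_ext _ _ fun j => ?_
      simp)

instance : (tensor K L (D := D)).Additive where
  map_add {X Y f g} := hom_ext
    (show biproduct.map (fun _ => f + g) = biproduct.map (fun _ => f) + biproduct.map (fun _ => g) by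
      refine biproduct.hom_ext _ _ fun j => ?_
      refine Eq.trans ?_ (Preadditive.add_comp _ _ _ _ _ _).symm
      simp)

/-- The projections from (the object underlying) `L ⊗_K X` to `X`. -/
def tensorπ (j : Fin (Module.finrank K L)) : tensor K L ⋙ forget K L D ⟶ 𝟭 D where
  app X := biproduct.π (fun _ => X) j
  naturality _ _ f := biproduct.map_π (fun _ => f) j

/-- The inclusions of `X` in (the object underlying) `L ⊗_K X`. -/
def tensorι (j : Fin (Module.finrank K L)) : 𝟭 D ⟶ tensor K L ⋙ forget K L D where
  app X := biproduct.ι (fun _ => X) j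
  naturality _ _ f := (biproduct.ι_map (fun _ => f) j).symm

lemma tensor_total (X : D) :
    ∑ j, (tensorπ K L j).app X ≫ (tensorι K L j).app X =
      𝟙 ((tensor K L ⋙ forget K L D).obj X) :=
  biproduct.total (f := fun _ : Fin (Module.finrank K L) => X)

end ScalarExt

/-! ### Homotopy categories of complexes with bounded cohomology -/

/-- The complexes (up to homotopy) in an abelian category whose cohomology vanishes in all but
finitely many degrees. -/
def cohomologyBounded (C : Type u) [Category.{v} C] [Abelian C] :
    ObjectProperty (HomotopyCategory C (.up ℤ)) :=
  fun X => ∃ a b : ℤ, ∀ n : ℤ, n < a ∨ b < n →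
    IsZero ((HomotopyCategory.homologyFunctor C (.up ℤ) n).obj X)

section

variable {C : Type u} [Category.{v} C] [Abelian C]

instance : (cohomologyBounded C).IsClosedUnderIsomorphisms where
  of_iso := by
    rintro X Y e ⟨a, b, h⟩
    exact ⟨a, b, fun n hn => (h n hn).of_iso
      ((HomotopyCategory.homologyFunctor C (.up ℤ) n).mapIso e.symm)⟩

instance : (cohomologyBounded C).IsTriangulated where
  exists_zero := by
    obtain ⟨Z, hZ⟩ := HasZeroObject.zero (C := HomotopyCategory C (.up ℤ))
    exact ⟨Z, hZ, 0, 0, fun n _ => Functor.map_isZero _ hZ⟩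
  isStableUnderShiftBy k :=
    { le_shift := by
        rintro X ⟨a, b, h⟩
        refine ⟨a - k, b - k, fun n hn => ?_⟩
        exact (h (k + n) (by lia)).of_iso
          (((HomotopyCategory.homologyFunctor C (.up ℤ) 0).shiftIso k n (k + n) rfl).app X) }
  toIsTriangulatedClosed₂ := .mk' (by
    rintro T hT ⟨a, b, h⟩ ⟨a', b', h'⟩
    refine ⟨min a a', max b b', fun n hn => ?_⟩
    have ex := (HomotopyCategory.homologyFunctor C (.up ℤ) n).map_distinguished_exact T hT
    exact ex.isZero_X₂ ((h n (by lia)).eq_of_src _ _) ((h' n (by lia)).eq_of_tgt _ _))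

end

/-- For an additive functor `F : D ⥤ C` to an abelian category: the bounded below complexes in `D`
(up to homotopy) whose image in `C` has bounded cohomology. -/
abbrev boundedVia {D : Type*} [Category* D] [Preadditive D]
    {C : Type u} [Category.{v} C] [Abelian C] (F : D ⥤ C) [F.Additive] :
    ObjectProperty (HomotopyCategory.Plus D) :=
  (cohomologyBounded C).inverseImage
    (F.mapHomotopyCategoryPlus ⋙ HomotopyCategory.Plus.ι C)

/-! ### Base change of the bounded derived category -/

section

variable (K L : Type*) [Field K] [Field L] [Algebra K L]
  (C : Type u) [Category.{v} C] [Abelian C] [Linear K C]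

/-- The homotopy category `H⁰(𝒜)` of the DG-category `𝒜` of bounded below complexes of injective
objects of `C` with bounded cohomology. If `C` has enough injectives, `𝒜` is an enhancement of
`Dᵇ(C)`. -/
abbrev InjectiveModel : Type _ := (boundedVia (InjectiveObject.ι C)).FullSubcategory

/-- The homotopy category `H⁰(𝒜_L)`, where `𝒜` is the DG-category of bounded below complexes of
injective objects of `C` with bounded cohomology.

An object of `𝒜_L` is an object of `𝒜` with a homomorphism of DG-algebras from `L` to its
endomorphism DG-algebra. As `L` sits in degree `0` and has zero differential, this is an action of
`L` by endomorphisms of complexes, so that an object of `𝒜_L` is a complex in `I(C)_L`, where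
`I(C)` is the category of injective objects of `C`. The degree `n` morphisms of `𝒜_L` are the
families of morphisms of degree `n` in `I(C)_L`. So `H⁰` has as morphisms the morphisms of
complexes in `I(C)_L` up to homotopy in `I(C)_L`. The DG-category `𝒜_L` has all shifts and
cones, so it is its own pretriangulated hull up to DG-equivalence, and the triangulated structure
on `H⁰(𝒜_L) = H⁰((𝒜_L)^pretr)` is the one given by mapping cones. -/
abbrev InjectiveModelExt : Type _ :=
  (boundedVia (ScalarExt.forget K L (InjectiveObject C) ⋙ InjectiveObject.ι C)).FullSubcategory

variable [FiniteDimensional K L]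

variable {C} in
lemma boundedVia_tensor (X : HomotopyCategory.Plus (InjectiveObject C))
    (hX : boundedVia (InjectiveObject.ι C) X) :
    boundedVia (ScalarExt.forget K L (InjectiveObject C) ⋙ InjectiveObject.ι C)
      ((ScalarExt.tensor K L).mapHomotopyCategoryPlus.obj X) := by
  obtain ⟨a, b, h⟩ := hX
  refine ⟨a, b, fun n hn => ?_⟩
  obtain ⟨X, hX⟩ := X
  obtain ⟨M, rfl⟩ := HomotopyCategory.quotient_obj_surjective X
  let F := InjectiveObject.ι C
  let G := ScalarExt.tensor K L ⋙ ScalarExt.forget K L (InjectiveObject C) ⋙ InjectiveObject.ι C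
  let p (j : Fin (Module.finrank K L)) : G ⟶ F :=
    Functor.whiskerRight (ScalarExt.tensorπ K L j) (InjectiveObject.ι C)
  let i (j : Fin (Module.finrank K L)) : F ⟶ G :=
    Functor.whiskerRight (ScalarExt.tensorι K L j) (InjectiveObject.ι C)
  have key : ∑ j, (NatTrans.mapHomologicalComplex (p j) (.up ℤ)).app M ≫
      (NatTrans.mapHomologicalComplex (i j) (.up ℤ)).app M = 𝟙 _ := by
    ext k
    refine ((HomologicalComplex.eval C (.up ℤ) k).map_sum _ _).trans ?_
    refine Eq.trans ?_ ((congrArg (InjectiveObject.ι C).map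
      (ScalarExt.tensor_total K L (M.X k))).trans ((InjectiveObject.ι C).map_id _))
    refine Eq.trans ?_ ((InjectiveObject.ι C).map_sum (fun j =>
      (ScalarExt.tensorπ K L j).app (M.X k) ≫ (ScalarExt.tensorι K L j).app (M.X k)) _).symm
    exact Finset.sum_congr rfl fun j _ => ((InjectiveObject.ι C).map_comp _ _).symm
  let H := HomologicalComplex.homologyFunctor C (.up ℤ) n
  have hF : IsZero (H.obj ((F.mapHomologicalComplex (.up ℤ)).obj M)) :=
    (h n hn).of_iso ((HomotopyCategory.homologyFunctorFactors C (.up ℤ) n).app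
      ((F.mapHomologicalComplex (.up ℤ)).obj M)).symm
  have hG : IsZero (H.obj ((G.mapHomologicalComplex (.up ℤ)).obj M)) := by
    rw [IsZero.iff_id_eq_zero, ← H.map_id, ← key, H.map_sum]
    refine Finset.sum_eq_zero fun j _ => ?_
    rw [H.map_comp, hF.eq_of_tgt (H.map _) 0, zero_comp]
  exact hG.of_iso ((HomotopyCategory.homologyFunctorFactors C (.up ℤ) n).app
      ((G.mapHomologicalComplex (.up ℤ)).obj M))

/-- The functor `p^* : H⁰(𝒜) ⥤ H⁰(𝒜_L)` induced by `X ↦ L ⊗_K X`. -/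
def baseChangeFunctor : InjectiveModel C ⥤ InjectiveModelExt K L C :=
  ObjectProperty.lift _
    ((boundedVia (InjectiveObject.ι C)).ι ⋙ (ScalarExt.tensor K L).mapHomotopyCategoryPlus)
    fun X => boundedVia_tensor K L X.obj X.property

instance : (baseChangeFunctor K L C).essImage.Nonempty := by
  obtain ⟨Z, -⟩ := HasZeroObject.zero (C := InjectiveModel C)
  exact ⟨_, (baseChangeFunctor K L C).obj_mem_essImage Z⟩

/-- The base change `Dᵇ(C)_L`: the smallest thick full triangulated subcategory of `H⁰(𝒜_L)` that
contains the image of `Dᵇ(C) = H⁰(𝒜)` under `p^*`. -/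
def baseChangeDb : ObjectProperty (InjectiveModelExt K L C) :=
  (baseChangeFunctor K L C).essImage.triangEnvelope

instance : (baseChangeDb K L C).IsTriangulated :=
  inferInstanceAs (baseChangeFunctor K L C).essImage.triangEnvelope.IsTriangulated

/-- The triangulated category `Dᵇ(C)_L`. -/
abbrev BaseChangeDb : Type _ := (baseChangeDb K L C).FullSubcategory

instance : Pretriangulated (BaseChangeDb K L C) :=
  ObjectProperty.instPretriangulatedFullSubcategory (baseChangeDb K L C)

end

/-! ### The dimension of a triangulated category -/

/-- The dimension of a triangulated category: the smallest `d : ℕ` such that there is an object `E`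
from which every object is obtained by shifts, finite direct sums, direct summands and `d`
extensions, i.e. `⟨E⟩_{d+1}` is the whole category; it is `⊤` if there is no such `d`. -/
def rouquierDim (T : Type*) [Category* T] [HasZeroObject T] [HasShift T ℤ] [Preadditive T]
    [∀ n : ℤ, (shiftFunctor T n).Additive] [Pretriangulated T] : ℕ∞ :=
  ⨅ (d : ℕ) (_ : ∃ E : T, (ObjectProperty.singleton E).triangEnvelopeIter d = ⊤), (d : ℕ∞)

end

/-! The dimension cannot grow along a triangulated functor `F : T ⥤ S` for which every object of `S`
is a direct summand of some `F X`: if `E` generates `T` in `d` extensions, then `F E` generates `S`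
in `d` extensions (`rouquierDim_le_of_retract`). This is applied to extension of scalars `p^*` and
restriction of scalars `p_*`, once in each direction.

For `p_*`: the object underlying `L ⊗_K X` is a sum of `[L : K] > 0` copies of `X`, so `X` is a
summand of `p_* p^* X`. For `p^*`: a Galois extension is separable, so the trace form is
nondegenerate. If `b_i` is a basis of `L` and `b_i^*` its trace dual, then `y ↦ ∑ b_i ⊗ b_i^* y` is
an `L`-linear section of the action map `L ⊗_K Y → Y`, and `Y` is a summand of `p^* p_* Y`. Both
splittings are natural in `I(C)`, so they extend degreewise to complexes and to homotopy categories.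

This gives the equality with the dimension of `H⁰(𝒜)`. Complexes of injectives then identify `H⁰(𝒜)`
with `Dᵇ(C)` as a triangulated category. -/

noncomputable section

/-! ### Dimension and triangulated functors -/

namespace CategoryTheory.ObjectProperty

open Pretriangulated

lemma shiftClosure_le_inverseImage {T S : Type*} [Category* T] [HasShift T ℤ] [Category* S]
    [HasShift S ℤ] (F : T ⥤ S) [F.CommShift ℤ] {P : ObjectProperty T} {Q : ObjectProperty S}
    (h : P ≤ Q.inverseImage F) : P.shiftClosure ℤ ≤ (Q.shiftClosure ℤ).inverseImage F := by
  rintro X ⟨Y, n, e, hY⟩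
  exact ⟨F.obj Y, n, F.mapIso e ≪≫ (F.commShiftIso n).app Y, h _ hY⟩

lemma retractClosure_le_inverseImage {T S : Type*} [Category* T] [Category* S] (F : T ⥤ S)
    {P : ObjectProperty T} {Q : ObjectProperty S}
    (h : P ≤ Q.inverseImage F) : P.retractClosure ≤ Q.retractClosure.inverseImage F := by
  rintro X ⟨Y, hY, ⟨r⟩⟩
  exact ⟨F.obj Y, h _ hY, ⟨r.map F⟩⟩

variable {T S : Type*} [Category* T] [HasZeroObject T] [HasShift T ℤ] [Preadditive T]
  [∀ n : ℤ, (shiftFunctor T n).Additive] [Pretriangulated T]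
  [Category* S] [HasZeroObject S] [HasShift S ℤ] [Preadditive S]
  [∀ n : ℤ, (shiftFunctor S n).Additive] [Pretriangulated S]
  (F : T ⥤ S) [F.CommShift ℤ] [F.IsTriangulated]

/-- A triangulated functor is additive, so it carries a presentation as a finite product to another
one. -/
lemma binaryProductsClosure_le_inverseImage {P : ObjectProperty T} {Q : ObjectProperty S}
    (h : P ≤ Q.inverseImage F) :
    P.binaryProductsClosure ≤ Q.binaryProductsClosure.inverseImage F := by
  intro X hX
  induction hX with
  | of_mem X hX => exact limitsClosure.of_mem _ (h _ hX)
  | of_isoClosure e _ hX => exact limitsClosure.of_isoClosure (F.mapIso e) hX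
  | of_limitPresentation pres _ h' =>
    exact limitsClosure.of_limitPresentation (a := ()) (pres.map F) h'

lemma extensionProductIter_le_inverseImage {P : ObjectProperty T} {Q : ObjectProperty S}
    (h : P ≤ Q.inverseImage F) (n : ℕ) :
    P.extensionProductIter n ≤ (Q.extensionProductIter n).inverseImage F := by
  induction n with
  | zero => exact h
  | succ n ih =>
    rw [extensionProductIter_succ, extensionProductIter_succ]
    rintro X ⟨X₁, X₃, f, g, k, hT, h₁, h₃⟩
    exact ⟨_, _, _, _, _, F.map_distinguished _ hT, h _ h₁, ih _ h₃⟩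

/-- A triangulated functor is compatible with the formation of the iterated envelopes. -/
lemma triangEnvelopeIter_le_inverseImage {P : ObjectProperty T} {Q : ObjectProperty S}
    (h : P ≤ Q.inverseImage F) (n : ℕ) :
    P.triangEnvelopeIter n ≤ (Q.triangEnvelopeIter n).inverseImage F :=
  retractClosure_le_inverseImage F (extensionProductIter_le_inverseImage F
    (retractClosure_le_inverseImage F (binaryProductsClosure_le_inverseImage F
      (shiftClosure_le_inverseImage F h))) n)

end CategoryTheory.ObjectProperty

/-- If every object of `S` is a direct summand of the image of an object of `T` under a triangulated
functor, then the dimension of `S` is at most that of `T`. -/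
lemma rouquierDim_le_of_retract {T S : Type*}
    [Category* T] [HasZeroObject T] [HasShift T ℤ] [Preadditive T]
    [∀ n : ℤ, (shiftFunctor T n).Additive] [Pretriangulated T]
    [Category* S] [HasZeroObject S] [HasShift S ℤ] [Preadditive S]
    [∀ n : ℤ, (shiftFunctor S n).Additive] [Pretriangulated S]
    (F : T ⥤ S) [F.CommShift ℤ] [F.IsTriangulated]
    (hF : ∀ Y : S, ∃ X : T, Nonempty (Retract Y (F.obj X))) :
    rouquierDim S ≤ rouquierDim T := by
  refine le_iInf₂ fun d hd => ?_
  obtain ⟨E, hE⟩ := hd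
  refine iInf₂_le d ⟨F.obj E, eq_top_iff.2 fun Y _ => ?_⟩
  obtain ⟨X, ⟨r⟩⟩ := hF Y
  refine ObjectProperty.prop_of_retract _ r
    (ObjectProperty.triangEnvelopeIter_le_inverseImage F
      (P := ObjectProperty.singleton E) ?_ d X (by rw [hE]; trivial))
  rintro _ ⟨⟩
  exact ObjectProperty.ofObj_apply _ PUnit.unit

/-- Serves for `p_*`, which is defined on all of `H⁰(𝒜_L)` but is needed on the subcategory
`Dᵇ(C)_L`. -/
lemma rouquierDim_le_of_retract_fullSubcategory {T S : Type*}
    [Category* T] [HasZeroObject T] [HasShift T ℤ] [Preadditive T]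
    [∀ n : ℤ, (shiftFunctor T n).Additive] [Pretriangulated T]
    [Category* S] [HasZeroObject S] [HasShift S ℤ] [Preadditive S]
    [∀ n : ℤ, (shiftFunctor S n).Additive] [Pretriangulated S]
    (P : ObjectProperty T) [P.IsTriangulated] (F : T ⥤ S) [F.CommShift ℤ] [F.IsTriangulated]
    (hF : ∀ Y : S, ∃ X : P.FullSubcategory, Nonempty (Retract Y (F.obj X.obj))) :
    rouquierDim S ≤ rouquierDim P.FullSubcategory :=
  rouquierDim_le_of_retract (P.ι ⋙ F) hF

/-- A quasi-inverse is an adjoint and so inherits a triangulated structure. Unit and counit are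
isomorphisms, in particular retractions, which gives both inequalities. -/
lemma rouquierDim_eq_of_isEquivalence {T S : Type*}
    [Category* T] [HasZeroObject T] [HasShift T ℤ] [Preadditive T]
    [∀ n : ℤ, (shiftFunctor T n).Additive] [Pretriangulated T]
    [Category* S] [HasZeroObject S] [HasShift S ℤ] [Preadditive S]
    [∀ n : ℤ, (shiftFunctor S n).Additive] [Pretriangulated S]
    (F : T ⥤ S) [F.CommShift ℤ] [F.IsTriangulated] [F.IsEquivalence] :
    rouquierDim T = rouquierDim S := by
  let adj : F ⊣ F.inv := F.asEquivalence.toAdjunction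
  let : F.inv.CommShift ℤ := adj.rightAdjointCommShift ℤ
  have : adj.CommShift ℤ := adj.commShift_of_leftAdjoint ℤ
  have : F.inv.IsTriangulated := adj.isTriangulated_rightAdjoint
  apply le_antisymm
  · exact rouquierDim_le_of_retract F.inv fun X =>
      ⟨_, ⟨.ofIso (F.asEquivalence.unitIso.app X)⟩⟩
  · exact rouquierDim_le_of_retract F fun Y =>
      ⟨_, ⟨.ofIso (F.asEquivalence.counitIso.symm.app Y)⟩⟩

/-! ### Trace duality and the splitting of the action map -/

namespace ScalarExt

variable (K L : Type*) [Field K] [Field L] [Algebra K L]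
  {D : Type u} [Category.{v} D] [Preadditive D] [Linear K D]

variable {K L} in
lemma ρ_smul (X : ScalarExt K L D) (r : K) (l : L) : X.ρ (r • l) = r • X.ρ l :=
  map_smul X.act r l

variable {K L} in
lemma ρ_sum (X : ScalarExt K L D) {ι : Type*} (s : Finset ι) (l : ι → L) :
    X.ρ (∑ i ∈ s, l i) = ∑ i ∈ s, X.ρ (l i) :=
  map_sum X.act l s

variable {K L} in
lemma map_comp_desc [HasFiniteBiproducts D] {Y Z : ScalarExt K L D} (f : Y ⟶ Z) {n : ℕ}
    (b : Fin n → L) :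
    biproduct.map (fun _ => f.hom) ≫ biproduct.desc (fun i => Z.ρ (b i)) =
      biproduct.desc (fun i => Y.ρ (b i)) ≫ f.hom := by
  refine biproduct.hom_ext' _ _ fun i => ?_
  simp [f.comm]

variable {K L} in
lemma comp_lift [HasFiniteBiproducts D] {Y Z : ScalarExt K L D} (f : Y ⟶ Z) {n : ℕ}
    (b : Fin n → L) :
    f.hom ≫ biproduct.lift (fun i => Z.ρ (b i)) =
      biproduct.lift (fun i => Y.ρ (b i)) ≫ biproduct.map (fun _ => f.hom) := by
  refine biproduct.hom_ext _ _ fun i => ?_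
  simp [f.comm]

variable [FiniteDimensional K L]

section

variable [Algebra.IsSeparable K L]

/-- The basis of `L` that is dual, for the trace form, to the one that defines `L ⊗_K X`. -/
def traceDual : Module.Basis (Fin (Module.finrank K L)) K L :=
  (Algebra.traceForm K L).dualBasis (traceForm_nondegenerate K L) (Module.finBasis K L)

/-- Pairing with the dual basis reads off coordinates; the identities for the dual basis below are
checked by this pairing. -/
lemma trace_traceDual_mul (i : Fin (Module.finrank K L)) (x : L) :
    Algebra.trace K L (traceDual K L i * x) = (Module.finBasis K L).repr x i := by
  have h (j) : Algebra.trace K L (traceDual K L i * Module.finBasis K L j) =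
      if j = i then 1 else 0 := by
    rw [traceDual, ← Algebra.traceForm_apply, LinearMap.BilinForm.apply_dualBasis_left]
  conv_lhs => rw [← (Module.finBasis K L).sum_repr x]
  simp only [Finset.mul_sum, mul_smul_comm, map_sum, map_smul, h]
  simp

lemma eq_of_forall_trace_mul_eq {x y : L}
    (h : ∀ z, Algebra.trace K L (x * z) = Algebra.trace K L (y * z)) : x = y := by
  have := (traceForm_nondegenerate K L).1 (x - y) (fun z => by
    rw [Algebra.traceForm_apply, sub_mul, map_sub, h, sub_self])
  exact sub_eq_zero.1 this

/-- Pair both sides with `z`: the trace of `b_i^* z b_i` is the `i`-th coordinate of `z b_i`, a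
diagonal entry of the matrix of multiplication by `z`. These entries add up to the trace of `z`. -/
lemma sum_finBasis_mul_traceDual :
    ∑ i, Module.finBasis K L i * traceDual K L i = 1 := by
  refine eq_of_forall_trace_mul_eq K L fun z => ?_
  rw [one_mul, Algebra.trace_eq_matrix_trace (Module.finBasis K L) z, Matrix.trace,
    Finset.sum_mul, map_sum]
  refine Finset.sum_congr rfl fun i _ => ?_
  rw [mul_comm (Module.finBasis K L i), mul_assoc, trace_traceDual_mul, mul_comm _ z,
    Matrix.diag_apply, Algebra.leftMulMatrix_eq_repr_mul]

/-- Multiplication by `l` is self-adjoint for the trace form, so it acts on the dual basis by the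
transposed matrix. This is what makes the section of the action map `L`-linear. -/
lemma mul_traceDual (l : L) (j : Fin (Module.finrank K L)) :
    l * traceDual K L j =
      ∑ i, Algebra.leftMulMatrix (Module.finBasis K L) l j i • traceDual K L i := by
  refine eq_of_forall_trace_mul_eq K L fun z => ?_
  rw [mul_comm l, mul_assoc, trace_traceDual_mul, Finset.sum_mul, map_sum]
  simp_rw [smul_mul_assoc, map_smul, trace_traceDual_mul, smul_eq_mul]
  exact (congrFun (Algebra.leftMulMatrix_mulVec_repr (Module.finBasis K L) l z) j).symm

end

variable (D) [HasFiniteBiproducts D]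

variable {D} in
lemma leftMulMatrix_comp_desc (Y : ScalarExt K L D) (l : L) :
    biproduct.matrix (fun i j : Fin (Module.finrank K L) =>
      Algebra.leftMulMatrix (Module.finBasis K L) l j i • 𝟙 Y.obj) ≫
        biproduct.desc (fun i => Y.ρ (Module.finBasis K L i)) =
      biproduct.desc (fun i => Y.ρ (Module.finBasis K L i)) ≫ Y.ρ l := by
  refine biproduct.hom_ext' _ _ fun i => ?_
  simp only [biproduct.ι_matrix_assoc, biproduct.lift_desc, Linear.smul_comp,
    Category.id_comp, biproduct.ι_desc_assoc]
  rw [← ρ_mul, mul_comm, ← (Module.finBasis K L).sum_repr (l * _), ρ_sum]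
  refine Finset.sum_congr rfl fun j _ => ?_
  rw [ρ_smul, Algebra.leftMulMatrix_eq_repr_mul]

variable {D} in
lemma lift_comp_leftMulMatrix [Algebra.IsSeparable K L] (Y : ScalarExt K L D) (l : L) :
    Y.ρ l ≫ biproduct.lift (fun i => Y.ρ (traceDual K L i)) =
      biproduct.lift (fun i => Y.ρ (traceDual K L i)) ≫
        biproduct.matrix (fun i j : Fin (Module.finrank K L) =>
          Algebra.leftMulMatrix (Module.finBasis K L) l j i • 𝟙 Y.obj) := by
  refine biproduct.hom_ext _ _ fun j => ?_
  simp only [Category.assoc, biproduct.lift_π, biproduct.matrix_π, biproduct.lift_desc,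
    Linear.comp_smul, Category.comp_id]
  rw [← ρ_mul, mul_traceDual, ρ_sum]
  exact Finset.sum_congr rfl fun i _ => ρ_smul _ _ _

/-- The counit `L ⊗_K Y ⟶ Y`. -/
def tensorCounit : forget K L D ⋙ tensor K L ⟶ 𝟭 (ScalarExt K L D) where
  app Y :=
    { hom := biproduct.desc fun i => Y.ρ (Module.finBasis K L i)
      comm := leftMulMatrix_comp_desc K L Y }
  naturality _ _ f := hom_ext (map_comp_desc f _)

/-- For a separable extension, the counit `L ⊗_K Y ⟶ Y` has a natural section, given by the
separability idempotent of `L/K`. -/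
def tensorCounitSection [Algebra.IsSeparable K L] :
    𝟭 (ScalarExt K L D) ⟶ forget K L D ⋙ tensor K L where
  app Y :=
    { hom := biproduct.lift fun i => Y.ρ (traceDual K L i)
      comm := lift_comp_leftMulMatrix K L Y }
  naturality _ _ f := hom_ext (comp_lift f _)

/-- The composite is the action of `∑ b_i b_i^* = 1`. -/
lemma tensorCounitSection_comp [Algebra.IsSeparable K L] :
    tensorCounitSection K L D ≫ tensorCounit K L D = 𝟙 _ := by
  ext Y
  change biproduct.lift (fun i => Y.ρ (traceDual K L i)) ≫
    biproduct.desc (fun i => Y.ρ (Module.finBasis K L i)) = 𝟙 Y.obj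
  rw [biproduct.lift_desc, ← ρ_one, ← sum_finBasis_mul_traceDual K L, ρ_sum]
  exact Finset.sum_congr rfl fun i _ => by rw [mul_comm, ρ_mul]

lemma tensorι_comp_tensorπ (j : Fin (Module.finrank K L)) :
    tensorι K L j ≫ tensorπ K L (D := D) j = 𝟙 _ := by
  ext X
  exact biproduct.ι_π_self _ _

end ScalarExt

/-- A natural retraction `𝟭 ⟶ F ⋙ G ⟶ 𝟭` for additive functors induces retractions in the homotopy
category of bounded below complexes. -/
def retractMapHomotopyCategoryPlus {A B : Type*} [Category* A] [Category* B] [Preadditive A]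
    [Preadditive B] {F : A ⥤ B} {G : B ⥤ A} [F.Additive] [G.Additive] (i : 𝟭 A ⟶ F ⋙ G)
    (p : F ⋙ G ⟶ 𝟭 A) (h : i ≫ p = 𝟙 _) (X : HomotopyCategory.Plus A) :
    Retract X (G.mapHomotopyCategoryPlus.obj (F.mapHomotopyCategoryPlus.obj X)) where
  i := ObjectProperty.homMk ((HomotopyCategory.quotient A (.up ℤ)).map
    ((NatTrans.mapHomologicalComplex i (.up ℤ)).app X.obj.as))
  r := ObjectProperty.homMk ((HomotopyCategory.quotient A (.up ℤ)).map
    ((NatTrans.mapHomologicalComplex p (.up ℤ)).app X.obj.as))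
  retract := by
    ext
    refine ((HomotopyCategory.quotient A (.up ℤ)).map_comp _ _).symm.trans ?_
    -- The composite is already the identity on complexes, so no homotopy has to be produced.
    refine (congrArg (HomotopyCategory.quotient A (.up ℤ)).map ?_).trans
      ((HomotopyCategory.quotient A (.up ℤ)).map_id _)
    ext n
    exact NatTrans.congr_app h (X.obj.as.X n)

/-! ### Extension and restriction of scalars on homotopy categories -/

section

variable (K L : Type*) [Field K] [Field L] [Algebra K L]
  (C : Type u) [Category.{v} C] [Abelian C] [Linear K C]

-- Boundedness in `𝒜_L` is by definition that of the underlying complex in `C`.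
variable {K L C} in
lemma boundedVia_forget (X : InjectiveModelExt K L C) :
    boundedVia (InjectiveObject.ι C)
      (((boundedVia (ScalarExt.forget K L (InjectiveObject C) ⋙ InjectiveObject.ι C)).ι ⋙
        (ScalarExt.forget K L (InjectiveObject C)).mapHomotopyCategoryPlus).obj X) :=
  X.property

/-- The functor `p_* : H⁰(𝒜_L) ⥤ H⁰(𝒜)` that forgets the action of `L`. -/
def restrictScalarsFunctor : InjectiveModelExt K L C ⥤ InjectiveModel C :=
  ObjectProperty.lift _
    ((boundedVia (ScalarExt.forget K L (InjectiveObject C) ⋙ InjectiveObject.ι C)).ι ⋙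
      (ScalarExt.forget K L (InjectiveObject C)).mapHomotopyCategoryPlus)
    boundedVia_forget

instance : (restrictScalarsFunctor K L C).CommShift ℤ :=
  inferInstanceAs ((ObjectProperty.lift _ _ _).CommShift ℤ)

instance : (restrictScalarsFunctor K L C).IsTriangulated :=
  inferInstanceAs ((ObjectProperty.lift _ _ _).IsTriangulated)

variable [FiniteDimensional K L]

instance : (baseChangeFunctor K L C).CommShift ℤ :=
  inferInstanceAs ((ObjectProperty.lift _ _ _).CommShift ℤ)

instance : (baseChangeFunctor K L C).IsTriangulated :=
  inferInstanceAs ((ObjectProperty.lift _ _ _).IsTriangulated)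

variable {K L C} in
/-- An object of `H⁰(𝒜_L)` is a direct summand of the base change of the underlying object. -/
def retractBaseChangeRestrictScalars [Algebra.IsSeparable K L] (Y : InjectiveModelExt K L C) :
    Retract Y ((baseChangeFunctor K L C).obj ((restrictScalarsFunctor K L C).obj Y)) :=
  let r := retractMapHomotopyCategoryPlus _ _
    (ScalarExt.tensorCounitSection_comp K L (InjectiveObject C)) Y.obj
  { i := ObjectProperty.homMk r.i
    r := ObjectProperty.homMk r.r
    retract := by ext : 1; exact r.retract }

variable {C} in
/-- An object of `H⁰(𝒜)` is a direct summand of the restriction of scalars of its base change. -/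
def retractRestrictScalarsBaseChange (X : InjectiveModel C) :
    Retract X ((restrictScalarsFunctor K L C).obj ((baseChangeFunctor K L C).obj X)) :=
  let r := retractMapHomotopyCategoryPlus _ _
    -- Any one of the copies of `X` in `L ⊗_K X` would do; index `0` exists because `L` is nonzero.
    (ScalarExt.tensorι_comp_tensorπ K L (InjectiveObject C) ⟨0, Module.finrank_pos⟩) X.obj
  { i := ObjectProperty.homMk r.i
    r := ObjectProperty.homMk r.r
    retract := by ext : 1; exact r.retract }

variable {C} in
lemma baseChangeDb_baseChangeFunctor_obj (X : InjectiveModel C) :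
    baseChangeDb K L C ((baseChangeFunctor K L C).obj X) :=
  ObjectProperty.le_triangEnvelope _ _ ((baseChangeFunctor K L C).obj_mem_essImage X)

/-- The functor `p^* : H⁰(𝒜) ⥤ Dᵇ(C)_L`. -/
def toBaseChangeDb : InjectiveModel C ⥤ BaseChangeDb K L C :=
  (baseChangeDb K L C).lift (baseChangeFunctor K L C)
    (baseChangeDb_baseChangeFunctor_obj K L)

instance : (toBaseChangeDb K L C).CommShift ℤ :=
  inferInstanceAs ((ObjectProperty.lift _ _ _).CommShift ℤ)

instance : (toBaseChangeDb K L C).IsTriangulated :=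
  inferInstanceAs ((ObjectProperty.lift _ _ _).IsTriangulated)

theorem rouquierDim_baseChangeDb_eq_injectiveModel [Algebra.IsSeparable K L] :
    rouquierDim (BaseChangeDb K L C) = rouquierDim (InjectiveModel C) := by
  apply le_antisymm
  · refine rouquierDim_le_of_retract (toBaseChangeDb K L C) fun Y =>
      ⟨(restrictScalarsFunctor K L C).obj Y.obj, ⟨?_⟩⟩
    -- The retraction lives in `H⁰(𝒜_L)`; as `Dᵇ(C)_L` is a full subcategory containing `p^* p_* Y`,
    -- it is also one there.
    let r := retractBaseChangeRestrictScalars Y.obj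
    exact { i := ObjectProperty.homMk r.i
            r := ObjectProperty.homMk r.r
            retract := by ext : 1; exact r.retract }
  · exact rouquierDim_le_of_retract_fullSubcategory (baseChangeDb K L C)
      (restrictScalarsFunctor K L C) fun X =>
        ⟨(toBaseChangeDb K L C).obj X, ⟨retractRestrictScalarsBaseChange K L X⟩⟩

end

/-! ### Bounded below complexes of injectives as a model of `Dᵇ(C)` -/

section

variable (C : Type u) [Category.{v} C] [Abelian C] [HasDerivedCategory.{w} C]

open DerivedCategory TStructure

variable {C} in
lemma bounded_Qh_obj_iff (X : HomotopyCategory C (.up ℤ)) :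
    t.bounded (DerivedCategory.Qh.obj X) ↔ cohomologyBounded C X := by
  have e (n : ℤ) : IsZero ((DerivedCategory.homologyFunctor C n).obj (Qh.obj X)) ↔
      IsZero ((HomotopyCategory.homologyFunctor C (.up ℤ) n).obj X) :=
    ((homologyFunctorFactorsh C n).app X).isZero_iff
  constructor
  · rintro ⟨⟨a, ha⟩, ⟨b, hb⟩⟩
    refine ⟨a, b, fun n hn => (e n).1 ?_⟩
    obtain hn | hn := hn
    · exact (DerivedCategory.isGE_iff _ a).1 ha n hn
    · exact (DerivedCategory.isLE_iff _ b).1 hb n hn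
  · rintro ⟨a, b, h⟩
    exact ⟨⟨a, (DerivedCategory.isGE_iff _ a).2 fun n hn => (e n).2 (h n (.inl hn))⟩,
      ⟨b, (DerivedCategory.isLE_iff _ b).2 fun n hn => (e n).2 (h n (.inr hn))⟩⟩

/-- The functor `H⁰(𝒜) ⥤ Dᵇ(C)`. -/
def injectiveModelToBounded : InjectiveModel C ⥤ DerivedCategory.Bounded C :=
  ObjectProperty.lift _ ((boundedVia (InjectiveObject.ι C)).ι ⋙
    (InjectiveObject.ι C).mapHomotopyCategoryPlus ⋙ HomotopyCategory.Plus.ι C ⋙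
      DerivedCategory.Qh) fun X => (bounded_Qh_obj_iff _).2 X.property

instance : (injectiveModelToBounded C).CommShift ℤ :=
  inferInstanceAs ((ObjectProperty.lift _ _ _).CommShift ℤ)

instance : (injectiveModelToBounded C).IsTriangulated :=
  inferInstanceAs ((ObjectProperty.lift _ _ _).IsTriangulated)

/-- A bounded below complex of injectives is K-injective, so morphisms into it in the derived
category are homotopy classes of maps of complexes. -/
lemma injectiveModelToBounded_map_bijective (X Y : InjectiveModel C) :
    Function.Bijective ((injectiveModelToBounded C).map : (X ⟶ Y) → _) := by
  have : CochainComplex.IsKInjective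
      ((InjectiveObject.ι C).mapHomotopyCategoryPlus.obj Y.obj).obj.as := by
    obtain ⟨n, hn⟩ := (HomotopyCategory.plus_quotient_obj_iff _).1
      ((InjectiveObject.ι C).mapHomotopyCategoryPlus.obj Y.obj).property
    have : CochainComplex.IsStrictlyGE
      ((InjectiveObject.ι C).mapHomotopyCategoryPlus.obj Y.obj).obj.as n := hn
    exact CochainComplex.isKInjective_of_injective _ n
  have h := CochainComplex.IsKInjective.Qh_map_bijective
    ((InjectiveObject.ι C).mapHomotopyCategoryPlus.obj X.obj).obj
    ((InjectiveObject.ι C).mapHomotopyCategoryPlus.obj Y.obj).obj.as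
  -- After composing with the full inclusion of `Dᵇ(C)` in the derived category, the map on
  -- morphisms factors through `Qh` and three fully faithful functors.
  rw [← Function.Bijective.of_comp_iff'
    (ObjectProperty.fullyFaithfulι (t : Triangulated.TStructure
      (DerivedCategory C)).bounded |>.map_bijective _ _)]
  exact (h.comp ((HomotopyCategory.Plus.fullyFaithfulι C).map_bijective _ _)).comp
    ((((Functor.FullyFaithful.ofFullyFaithful
      (InjectiveObject.ι C).mapHomotopyCategoryPlus).map_bijective _ _)).comp
      ((boundedVia (InjectiveObject.ι C)).fullyFaithfulι.map_bijective _ _))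

instance : (injectiveModelToBounded C).Full where
  map_surjective := (injectiveModelToBounded_map_bijective C _ _).2

instance : (injectiveModelToBounded C).Faithful where
  map_injective h := (injectiveModelToBounded_map_bijective C _ _).1 h

instance [EnoughInjectives C] : (injectiveModelToBounded C).EssSurj where
  mem_essImage Y := by
    -- With enough injectives, a bounded below object is represented by a bounded below complex of
    -- injectives. Its cohomology is that of `Y`, hence bounded.
    obtain ⟨X, ⟨e⟩⟩ := Functor.EssSurj.mem_essImage
      (F := (InjectiveObject.ι C).mapHomotopyCategoryPlus ⋙ DerivedCategory.Plus.Qh)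
      ⟨Y.obj, Y.property.1⟩
    let e' : DerivedCategory.Qh.obj
      ((InjectiveObject.ι C).mapHomotopyCategoryPlus.obj X).obj ≅ Y.obj :=
        DerivedCategory.Plus.ι.mapIso e
    have hX : boundedVia (InjectiveObject.ι C) X :=
      (bounded_Qh_obj_iff _).1 (t.bounded.prop_of_iso e'.symm Y.property)
    exact ⟨⟨X, hX⟩, ⟨t.bounded.fullyFaithfulι.preimageIso e'⟩⟩

instance [EnoughInjectives C] : (injectiveModelToBounded C).IsEquivalence where

theorem rouquierDim_injectiveModel_eq_bounded [EnoughInjectives C] :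
    rouquierDim (InjectiveModel C) = rouquierDim (DerivedCategory.Bounded C) :=
  rouquierDim_eq_of_isEquivalence (injectiveModelToBounded C)

end

end

theorem mainTheorem3 {K L : Type*} [Field K] [Field L] [Algebra K L] [FiniteDimensional K L]
    [IsGalois K L] {C : Type u} [Category.{v} C] [Abelian C] [Linear K C] [EnoughInjectives C]
    [HasDerivedCategory.{w} C] {ι : Type*} (G : ι → C)
    (hG : (ObjectProperty.ofObj G).IsSeparating)
    (hfin : rouquierDim (DerivedCategory.Bounded C) ≠ ⊤) :
    rouquierDim (BaseChangeDb K L C) = rouquierDim (DerivedCategory.Bounded C) :=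
  (rouquierDim_baseChangeDb_eq_injectiveModel K L C).trans
    (rouquierDim_injectiveModel_eq_bounded C)
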